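/- Let $d\ge 1$ be an integer and $\mathbb T=\mathbb R/\mathbb Z$. For positive integers $N_1,\dots,N_d$ define on $\mathbb T^{d}\times\mathbb T=\mathbb T^{d+1}$ the exponential sum $$S_{N_1,\dots,N_d}(\mathbf x,t)=\sum_{\mathbf n\in\mathbb Z^d,\ |n_j|\le N_j\ (1\le j\le d)} e^{2\pi i\,\mathbf n\cdot\mathbf x}\,e^{2\pi i|\mathbf n|^2t},\qquad |\mathbf n|^2=n_1^2+\dots+n_d^2,$$ and let $\|\cdot\|_p$ be the norm of $L^p(\mathbb T^{d+1})$ for the normalized Haar measure. Then for every $\varepsilon>0$ there is a constant $C>0$, depending only on $d$ and $\varepsilon$, such that for all positive integers $N_1,\dots,N_d$ $$\|S_{N_1,\dots,N_d}\|_{\frac{2(d+2)}{d}}\le C\,(N_1\cdots N_d)^{\frac{d}{2(d+2)}}\,\max\{N_1,\dots,N_d\}^{\frac{d}{d+2}+\varepsilon}.$$ In particular, for every positive integer $N$, $\|S_{N,\dots,N}\|_{\frac{2(d+2)}{d}}\le C N^{\frac d2+\varepsilon}$. This is sharp up to the factor $N^{\varepsilon}$: there is a constant $c>0$, depending only on $d$,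 such that $\|S_{N,\dots,N}\|_{\frac{2(d+2)}{d}}\ge c\,N^{\frac d2}$ for every positive integer $N$. -/

import Mathlib

open MeasureTheory

noncomputable section

/-- The box of all `n` in `ℤ^d` with `|n_j| ≤ N_j` for every `j`. -/
def freqBox {d : ℕ} (N : Fin d → ℕ) : Finset (Fin d → ℤ) :=
  Fintype.piFinset fun j => Finset.Icc (-(N j : ℤ)) (N j : ℤ)

/-- The exponential sum `∑ e^{2πi n·x} e^{2πi |n|² t}` over the box `|n_j| ≤ N_j`, as a function on
the torus `𝕋^d × 𝕋 = 𝕋^{d+1}` with `𝕋 = ℝ/ℤ`; here `fourier k y` is `e^{2πi k y}`. -/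
def expSum {d : ℕ} (N : Fin d → ℕ) (z : (Fin d → UnitAddCircle) × UnitAddCircle) : ℂ :=
  ∑ n ∈ freqBox N, (∏ j, fourier (n j) (z.1 j)) * fourier (∑ j, n j ^ 2) z.2

/-- The `L^p` norm, at `p = 2(d+2)/d`, of the exponential sum on the torus with its Haar
probability measure (the product of the normalized Lebesgue measures of the circles). -/
def expSumNorm {d : ℕ} (N : Fin d → ℕ) : ENNReal :=
  eLpNorm (expSum N) (ENNReal.ofReal (2 * ((d : ℝ) + 2) / d))
    (volume : Measure ((Fin d → UnitAddCircle) × UnitAddCircle))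

/-- The exponential sum in real coordinates. -/
theorem expSum_coe {d : ℕ} (N : Fin d → ℕ) (x : Fin d → ℝ) (t : ℝ) :
    expSum N (fun j => (x j : UnitAddCircle), (t : UnitAddCircle)) =
      ∑ n ∈ freqBox N, Complex.exp (2 * Real.pi * Complex.I * ∑ j, (n j : ℂ) * (x j : ℂ)) *
        Complex.exp (2 * Real.pi * Complex.I * (∑ j, (n j : ℂ) ^ 2) * (t : ℂ)) := by
  unfold expSum
  refine Finset.sum_congr rfl fun n _ => ?_
  simp only [fourier_coe_apply]
  rw [← Complex.exp_sum, Finset.mul_sum]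
  push_cast
  congr 2
  · refine Finset.sum_congr rfl fun j _ => ?_
    ring
  · ring

end

/-! With p = 2(d+2)/d = 2 + 4/d, the sum S factors into one-dimensional Weyl sums, and |S|^p = |S|^2
· |S|^(4/d). Weyl differencing bounds every squared factor by 16 times one function of t alone,
`weylMajorant`, so |S|^(4/d) ≤ 256 `weylMajorant`^2 (`norm_expSum_rpow_le`). The remaining |S|^2 is
integrated in x by Parseval and gives ∏(2N_j+1), whatever t is. What is left is the mean square of
`weylMajorant` in t. The geometric sums produced by differencing are dominated by `fejerMajorant`, a
trigonometric polynomial with nonnegative coefficients of logarithmic size, so Parseval reduces this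
mean square to counting hk = h'k' with variables at most R. There are O(R^2 log^2 R) solutions
(`card_mulEnergyInt_le`); logarithms cost the ε. Sharpness: S has size about M^d on a box about the
origin of measure about M^(-(d+2)). -/

/-! ### A positive majorant for geometric sums -/

/-- A Fejér-type majorant: the sum of `|1 + z + ⋯ + z ^ (M - 1)|² / M²` over `1 ≤ M ≤ L`. -/
noncomputable def fejerMajorant (L : ℕ) (z : ℂ) : ℝ :=
  ∑ M ∈ Finset.Icc 1 L, ‖∑ k ∈ Finset.range M, z ^ k‖ ^ 2 / (M : ℝ) ^ 2

theorem fejerMajorant_nonneg (L : ℕ) (z : ℂ) : 0 ≤ fejerMajorant L z :=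
  Finset.sum_nonneg fun _ _ => by positivity

theorem fejerMajorant_mono {L L' : ℕ} (h : L ≤ L') (z : ℂ) :
    fejerMajorant L z ≤ fejerMajorant L' z :=
  Finset.sum_le_sum_of_subset_of_nonneg (Finset.Icc_subset_Icc_right h)
    fun _ _ _ => by positivity

theorem norm_pow_sub_one_le_mul {z : ℂ} (hz : ‖z‖ = 1) (k : ℕ) :
    ‖z ^ k - 1‖ ≤ k * ‖z - 1‖ := by
  induction k with
  | zero => simp
  | succ k ih =>
    have : z ^ (k + 1) - 1 = z ^ k * (z - 1) + (z ^ k - 1) := by ring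
    rw [this]
    refine (norm_add_le _ _).trans ?_
    rw [norm_mul, norm_pow, hz, one_pow, one_mul]
    push_cast
    linarith

/-- There is no cancellation: z^k deviates from 1 by at most k‖z - 1‖, and these deviations add up
to at most M/2. -/
theorem half_le_norm_geom_sum {z : ℂ} (hz : ‖z‖ = 1) {M : ℕ} (hM : M * ‖z - 1‖ ≤ 1) :
    (M : ℝ) / 2 ≤ ‖∑ k ∈ Finset.range M, z ^ k‖ := by
  have h1 : ‖∑ k ∈ Finset.range M, (z ^ k - 1)‖ ≤ (M : ℝ) / 2 := by
    refine (norm_sum_le _ _).trans ?_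
    refine (Finset.sum_le_sum fun k _ => norm_pow_sub_one_le_mul hz k).trans ?_
    rw [← Finset.sum_mul]
    have h2 : (∑ k ∈ Finset.range M, (k : ℝ)) * 2 = M * (M - 1) := by
      clear hM
      induction M with
      | zero => simp
      | succ n ih => rw [Finset.sum_range_succ, add_mul, ih]; push_cast; ring
    have h3 : (∑ k ∈ Finset.range M, (k : ℝ)) ≤ M * M / 2 := by
      have : (0 : ℝ) ≤ M := by positivity
      nlinarith
    calc _ ≤ (M * M / 2 : ℝ) * ‖z - 1‖ := by gcongr
      _ = M / 2 * (M * ‖z - 1‖) := by ring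
      _ ≤ M / 2 * 1 := by gcongr
      _ = _ := by ring
  rw [Finset.sum_sub_distrib] at h1
  simp only [Finset.sum_const, Finset.card_range, nsmul_eq_mul, mul_one] at h1
  have h4 := norm_sub_norm_le (M : ℂ) (∑ k ∈ Finset.range M, z ^ k)
  rw [norm_sub_rev, Complex.norm_natCast] at h4
  linarith

theorem quarter_le_fejerMajorant {z : ℂ} (hz : ‖z‖ = 1) {Q L : ℕ} (hQL : Q ≤ L)
    (hQ : Q * ‖z - 1‖ ≤ 1) : (Q : ℝ) / 4 ≤ fejerMajorant L z := by
  refine le_trans ?_ (fejerMajorant_mono hQL z)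
  have : ∑ M ∈ Finset.Icc 1 Q, (1 / 4 : ℝ) ≤ fejerMajorant Q z := by
    refine Finset.sum_le_sum fun M hM => ?_
    rw [Finset.mem_Icc] at hM
    have hM0 : (0 : ℝ) < M := by exact_mod_cast hM.1
    have hMQ : (M : ℝ) ≤ Q := by exact_mod_cast hM.2
    have := half_le_norm_geom_sum hz (M := M) (le_trans (by gcongr) hQ)
    rw [le_div_iff₀ (by positivity)]
    nlinarith
  simp at this
  linarith

/-- The sum is at most min(L, 2/‖z - 1‖), while every M up to min(L, 1/‖z - 1‖) contributes at least
1/4 to the majorant. -/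
theorem norm_geom_sum_le {z : ℂ} (hz : ‖z‖ = 1) (L : ℕ) :
    ‖∑ k ∈ Finset.range L, z ^ k‖ ≤ 16 * fejerMajorant L z := by
  have hK := fejerMajorant_nonneg L z
  by_cases hL : L * ‖z - 1‖ ≤ 1
  · have h1 := quarter_le_fejerMajorant hz le_rfl hL
    have h2 : ‖∑ k ∈ Finset.range L, z ^ k‖ ≤ L := by
      refine (norm_sum_le _ _).trans ?_
      simp [hz]
    linarith
  · push Not at hL
    set δ := ‖z - 1‖ with hδ
    have hδ0 : 0 < δ := by
      rcases (norm_nonneg (z - 1)).eq_or_lt with h | h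
      · rw [hδ, ← h] at hL; norm_num at hL
      · exact h
    have hL1 : 1 ≤ L := by
      rcases Nat.eq_zero_or_pos L with h | h
      · subst h; norm_num at hL
      · exact h
    have h2 : ‖∑ k ∈ Finset.range L, z ^ k‖ * δ ≤ 2 := by
      rw [hδ, ← norm_mul, geom_sum_mul]
      refine (norm_sub_le _ _).trans ?_
      simp [hz]; norm_num
    by_cases h1 : δ ≤ 1
    -- With Q = ⌊1/δ⌋ ≥ 1 one has 1/δ < Q + 1 ≤ 2Q, so 2/δ ≤ 4Q ≤ 16 · (Q/4): this is the source of
    -- the 16.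
    · have hfl : ((⌊1 / δ⌋₊ : ℕ) : ℝ) ≤ 1 / δ := Nat.floor_le (by positivity)
      have hfl1 : 1 ≤ ⌊1 / δ⌋₊ := Nat.le_floor (by rw [Nat.cast_one, le_div_iff₀ hδ0]; linarith)
      have hfl1' : (1 : ℝ) ≤ (⌊1 / δ⌋₊ : ℕ) := by exact_mod_cast hfl1
      have hfl2 := Nat.lt_floor_add_one (1 / δ)
      have hQL : ⌊1 / δ⌋₊ ≤ L := by
        have : (1 / δ) < L := by rw [div_lt_iff₀ hδ0]; linarith
        exact_mod_cast hfl.trans this.le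
      have h3 := quarter_le_fejerMajorant hz hQL (by rw [← le_div_iff₀ hδ0]; exact hfl)
      have h4 : ‖∑ k ∈ Finset.range L, z ^ k‖ ≤ 2 * (1 / δ) := by
        rw [mul_one_div, le_div_iff₀ hδ0]; exact h2
      linarith
    · push Not at h1
      have h3 : 1 ≤ fejerMajorant L z := by
        refine le_trans ?_ (fejerMajorant_mono hL1 z)
        simp [fejerMajorant]
      have := norm_nonneg (∑ k ∈ Finset.range L, z ^ k)
      nlinarith

theorem norm_zpow_sum_Icc_le {z : ℂ} (hz : ‖z‖ = 1) (a b : ℤ) {L : ℕ} (hL : b + 1 - a ≤ L) :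
    ‖∑ m ∈ Finset.Icc a b, z ^ m‖ ≤ 16 * fejerMajorant L z := by
  have hz0 : z ≠ 0 := by rintro rfl; simp at hz
  have h1 : ∑ m ∈ Finset.Icc a b, z ^ m
      = z ^ a * ∑ k ∈ Finset.range (b + 1 - a).toNat, z ^ k := by
    rw [Finset.mul_sum]
    refine (Finset.sum_bij (fun (k : ℕ) _ => a + (k : ℤ)) ?_ ?_ ?_ ?_).symm
    · intro k hk
      simp only [Finset.mem_range, Finset.mem_Icc] at *
      omega
    · intro k _ l _ h
      omega
    · intro m hm
      simp only [Finset.mem_Icc] at hm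
      exact ⟨(m - a).toNat, by simp only [Finset.mem_range]; omega, by omega⟩
    · intro k _
      rw [zpow_add₀ hz0, zpow_natCast]
  rw [h1, norm_mul, norm_zpow, hz, one_zpow, one_mul]
  refine (norm_geom_sum_le hz _).trans ?_
  have := fejerMajorant_mono (show (b + 1 - a).toNat ≤ L by omega) z
  linarith

theorem sum_inv_Icc_le (L : ℕ) : ∑ M ∈ Finset.Icc 1 L, (1 / (M : ℝ)) ≤ 1 + Real.log L := by
  have h := harmonic_le_one_add_log L
  rw [harmonic_eq_sum_Icc] at h
  push_cast at h
  simpa [one_div] using h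

theorem norm_sq_geom_sum {z : ℂ} (hz : ‖z‖ = 1) (M : ℕ) :
    ((‖∑ k ∈ Finset.range M, z ^ k‖ ^ 2 : ℝ) : ℂ)
      = ∑ p ∈ Finset.range M ×ˢ Finset.range M, z ^ ((p.1 : ℤ) - p.2) := by
  have hz0 : z ≠ 0 := by rintro rfl; simp at hz
  push_cast
  rw [← Complex.mul_conj', map_sum, Finset.sum_mul_sum, Finset.sum_product]
  refine Finset.sum_congr rfl fun k _ => Finset.sum_congr rfl fun l _ => ?_
  rw [map_pow, ← Complex.inv_eq_conj hz, zpow_sub₀ hz0, zpow_natCast, zpow_natCast, inv_pow]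
  rfl

/-- The coefficient at j sums r(M, j)/M^2, where r(M, j) ≤ M counts pairs in [0, M) with difference
j. Hence it is bounded by a harmonic sum. -/
theorem exists_fejerMajorant_coeff (L : ℕ) : ∃ c : ℤ → ℝ,
    (∀ j, 0 ≤ c j) ∧ (∀ j, c j ≤ 1 + Real.log L) ∧ ∀ z : ℂ, ‖z‖ = 1 →
      (fejerMajorant L z : ℂ) = ∑ j ∈ Finset.Icc (-(L : ℤ)) L, (c j : ℂ) * z ^ j := by
  let r : ℕ → ℤ → ℕ := fun M j =>
    ((Finset.range M ×ˢ Finset.range M).filter fun p => (p.1 : ℤ) - p.2 = j).card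
  have hr : ∀ M j, r M j ≤ M := by
    intro M j
    refine le_trans (Finset.card_le_card_of_injOn (t := Finset.range M) Prod.fst ?_ ?_) (by simp)
    · intro p hp
      simp at hp ⊢
      exact hp.1.1
    · intro p hp q hq h
      simp at hp hq
      ext
      · exact h
      · have := hp.2; have := hq.2; omega
  refine ⟨fun j => ∑ M ∈ Finset.Icc 1 L, (r M j : ℝ) / (M : ℝ) ^ 2,
    fun j => Finset.sum_nonneg fun _ _ => by positivity, fun j => ?_, fun z hz => ?_⟩
  · refine le_trans (Finset.sum_le_sum fun M hM => ?_) (sum_inv_Icc_le L)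
    rw [Finset.mem_Icc] at hM
    have hM0 : (0 : ℝ) < M := by exact_mod_cast hM.1
    have : (r M j : ℝ) ≤ M := by exact_mod_cast hr M j
    rw [div_le_div_iff₀ (by positivity) hM0]
    nlinarith
  · simp only [fejerMajorant, Complex.ofReal_sum, Finset.sum_mul]
    rw [Finset.sum_comm]
    refine Finset.sum_congr rfl fun M hM => ?_
    rw [Finset.mem_Icc] at hM
    rw [Complex.ofReal_div, norm_sq_geom_sum hz,
      ← Finset.sum_fiberwise_of_maps_to (t := Finset.Icc (-(L : ℤ)) L)
        (g := fun p : ℕ × ℕ => (p.1 : ℤ) - p.2), Finset.sum_div]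
    · refine Finset.sum_congr rfl fun j _ => ?_
      rw [Finset.sum_congr rfl (g := fun _ => z ^ j)]
      · rw [Finset.sum_const, nsmul_eq_mul]
        push_cast
        ring
      · intro p hp
        rw [(Finset.mem_filter.1 hp).2]
    · intro p hp
      simp only [Finset.mem_product, Finset.mem_range, Finset.mem_Icc] at *
      omega

/-! ### Counting solutions of hk = h'k' -/

/-- The solutions of `h k = h' k'` with all variables in `[0, R]`. -/
def mulEnergyNat (R : ℕ) : Finset ((ℕ × ℕ) × (ℕ × ℕ)) :=
  ((Finset.range (R + 1) ×ˢ Finset.range (R + 1)) ×ˢ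
    (Finset.range (R + 1) ×ˢ Finset.range (R + 1))).filter fun q => q.1.1 * q.1.2 = q.2.1 * q.2.2

theorem card_mulEnergyNat_zero_le (R : ℕ) :
    ((mulEnergyNat R).filter fun q => q.1.1 * q.1.2 = 0).card ≤ (2 * (R + 1)) ^ 2 := by
  let Z : Finset (ℕ × ℕ) := ({0} ×ˢ Finset.range (R + 1)) ∪ (Finset.range (R + 1) ×ˢ {0})
  have hZ : Z.card ≤ 2 * (R + 1) := by
    refine (Finset.card_union_le _ _).trans ?_
    simp; omega
  refine (Finset.card_le_card (t := Z ×ˢ Z) ?_).trans ?_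
  · rintro ⟨⟨a, b⟩, ⟨a', b'⟩⟩ h
    simp only [mulEnergyNat, Finset.mem_filter, Finset.mem_product, Finset.mem_range] at h
    obtain ⟨⟨⟨⟨h1, h2⟩, h3, h4⟩, h5⟩, h6⟩ := h
    have h7 : a' * b' = 0 := by rw [← h5]; exact h6
    simp only [Z, Finset.mem_product, Finset.mem_union, Finset.mem_range, Finset.mem_singleton]
    rcases mul_eq_zero.1 h6 with h | h <;> rcases mul_eq_zero.1 h7 with h' | h' <;> simp_all
  · rw [Finset.card_product, sq]
    exact Nat.mul_le_mul hZ hZ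

/-- Put g = gcd(h, h'), h = ag, h' = bg; coprimality of a and b forces k = bm, k' = am. For given
(a, b), both g and m are at most R/max(a, b), which leaves at most R²/(ab) choices. -/
theorem card_mulEnergyNat_pos_le (R : ℕ) :
    (((mulEnergyNat R).filter fun q => ¬ q.1.1 * q.1.2 = 0).card : ℝ)
      ≤ (R : ℝ) ^ 2 * (1 + Real.log R) ^ 2 := by
  let T : Finset ((_ : ℕ × ℕ) × (ℕ × ℕ)) :=
    (Finset.Icc 1 R ×ˢ Finset.Icc 1 R).sigma fun p =>
      Finset.Icc 1 (R / max p.1 p.2) ×ˢ Finset.Icc 1 (R / max p.1 p.2)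
  have h1 : ((mulEnergyNat R).filter fun q => ¬ q.1.1 * q.1.2 = 0).card ≤ T.card := by
    refine Finset.card_le_card_of_injOn (fun q => ⟨(q.1.1 / Nat.gcd q.1.1 q.2.1,
      q.2.1 / Nat.gcd q.1.1 q.2.1), (Nat.gcd q.1.1 q.2.1,
        q.1.2 / (q.2.1 / Nat.gcd q.1.1 q.2.1))⟩) ?_ ?_
    all_goals
      have key : ∀ h k h' k' : ℕ, ((h, k), (h', k')) ∈
          ((mulEnergyNat R).filter fun q => ¬ q.1.1 * q.1.2 = 0) →
          ∃ g a b m : ℕ, 0 < g ∧ 0 < a ∧ 0 < b ∧ 0 < m ∧ h = a * g ∧ h' = b * g ∧ k = b * m ∧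
            k' = a * m ∧ Nat.gcd h h' = g ∧ h ≤ R ∧ h' ≤ R ∧ k ≤ R ∧ k' ≤ R := by
        intro h k h' k' hq
        simp only [mulEnergyNat, Finset.mem_filter, Finset.mem_product, Finset.mem_range] at hq
        obtain ⟨⟨⟨⟨h1, h2⟩, h3, h4⟩, h5⟩, h6⟩ := hq
        have hh : 0 < h := Nat.pos_of_ne_zero fun h0 => h6 (by simp [h0])
        have hk : 0 < k := Nat.pos_of_ne_zero fun h0 => h6 (by simp [h0])
        have hh' : 0 < h' := Nat.pos_of_ne_zero fun h0 => h6 (by rw [h5, h0, zero_mul])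
        obtain ⟨a, b, hab, ha, hb⟩ := Nat.exists_coprime h h'
        have hg : 0 < Nat.gcd h h' := Nat.gcd_pos_of_pos_left _ hh
        set g := Nat.gcd h h' with hgdef
        have ha0 : 0 < a := Nat.pos_of_ne_zero fun h0 => by subst h0; omega
        have hb0 : 0 < b := Nat.pos_of_ne_zero fun h0 => by subst h0; omega
        have h7 : a * k = b * k' := by
          apply Nat.eq_of_mul_eq_mul_left hg
          calc g * (a * k) = (a * g) * k := by ring
            _ = (b * g) * k' := by rw [← ha, ← hb, h5]
            _ = _ := by ring
        have h8 : b ∣ k := hab.symm.dvd_of_dvd_mul_left ⟨k', h7⟩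
        obtain ⟨m, rfl⟩ := h8
        have h9 : k' = a * m := by
          apply Nat.eq_of_mul_eq_mul_left hb0
          rw [← h7]; ring
        exact ⟨g, a, b, m, hg, ha0, hb0, Nat.pos_of_mul_pos_left hk, ha, hb, rfl, h9, rfl,
          by omega, by omega, by omega, by omega⟩
    · rintro ⟨⟨h, k⟩, ⟨h', k'⟩⟩ hq
      obtain ⟨g, a, b, m, hg, ha, hb, hm, e1, e2, e3, e4, e5, l1, l2, l3, l4⟩ :=
        key h k h' k' hq
      subst e1 e2 e3 e4
      simp only [e5, Nat.mul_div_cancel _ hg, Nat.mul_div_cancel_left _ hb, T,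
        Finset.coe_sigma, Set.mem_sigma_iff, Finset.mem_coe, Finset.mem_product, Finset.mem_Icc]
      have hgp : ∀ x : ℕ, a * x ≤ R → b * x ≤ R → x ≤ R / max a b := by
        intro x hx1 hx2
        rw [Nat.le_div_iff_mul_le (lt_of_lt_of_le ha (le_max_left _ _))]
        rcases le_total a b with hab | hab
        · rw [max_eq_right hab, mul_comm]; exact hx2
        · rw [max_eq_left hab, mul_comm]; exact hx1
      refine ⟨⟨⟨ha, ?_⟩, hb, ?_⟩, ⟨hg, hgp g l1 l2⟩, hm, hgp m l4 l3⟩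
      · exact (Nat.le_mul_of_pos_right a hg).trans l1
      · exact (Nat.le_mul_of_pos_right b hg).trans l2
    · rintro ⟨⟨h, k⟩, ⟨h', k'⟩⟩ hq ⟨⟨u, v⟩, ⟨u', v'⟩⟩ hq' heq
      obtain ⟨g, a, b, m, hg, ha, hb, hm, e1, e2, e3, e4, e5, l1, l2, l3, l4⟩ :=
        key h k h' k' hq
      obtain ⟨g', a', b', m', hg', ha', hb', hm', e1', e2', e3', e4', e5', -⟩ :=
        key u v u' v' hq'
      subst e1 e2 e3 e4 e1' e2' e3' e4'
      simp only [e5, e5', Nat.mul_div_cancel _ hg, Nat.mul_div_cancel _ hg',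
        Nat.mul_div_cancel_left _ hb, Nat.mul_div_cancel_left _ hb', Sigma.mk.injEq,
        Prod.mk.injEq, heq_eq_eq] at heq
      obtain ⟨⟨rfl, rfl⟩, rfl, rfl⟩ := heq
      rfl
  have h2 : (T.card : ℝ) ≤ ∑ p ∈ Finset.Icc 1 R ×ˢ Finset.Icc 1 R,
      (R : ℝ) ^ 2 * ((1 / (p.1 : ℝ)) * (1 / (p.2 : ℝ))) := by
    simp only [T, Finset.card_sigma, Finset.card_product, Nat.card_Icc, Nat.add_sub_cancel]
    push_cast
    refine Finset.sum_le_sum fun p hp => ?_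
    simp only [Finset.mem_product, Finset.mem_Icc] at hp
    have ha : (0 : ℝ) < p.1 := by exact_mod_cast hp.1.1
    have hb : (0 : ℝ) < p.2 := by exact_mod_cast hp.2.1
    have h3 : ((R / max p.1 p.2 : ℕ) : ℝ) ≤ R / (p.1 : ℝ) := by
      refine Nat.cast_div_le.trans ?_
      push_cast
      gcongr
      exact le_max_left _ _
    have h4 : ((R / max p.1 p.2 : ℕ) : ℝ) ≤ R / (p.2 : ℝ) := by
      refine Nat.cast_div_le.trans ?_
      push_cast
      gcongr
      exact le_max_right _ _
    -- Bounding one factor through a and the other through b makes the double sum separate.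
    calc _ ≤ R / (p.1 : ℝ) * (R / (p.2 : ℝ)) := by gcongr
      _ = _ := by ring
  have h3 : ∑ p ∈ Finset.Icc 1 R ×ˢ Finset.Icc 1 R,
      (R : ℝ) ^ 2 * ((1 / (p.1 : ℝ)) * (1 / (p.2 : ℝ)))
        = (R : ℝ) ^ 2 * (∑ M ∈ Finset.Icc 1 R, (1 / (M : ℝ))) ^ 2 := by
    rw [← Finset.mul_sum, Finset.sum_product, sq (∑ M ∈ Finset.Icc 1 R, (1 / (M : ℝ))),
      Finset.sum_mul_sum]
  refine (Nat.cast_le.2 h1).trans (h2.trans (h3.le.trans ?_))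
  have := sum_inv_Icc_le R
  gcongr

/-- The solutions of `h k = h' k'` with all variables in `[-R, R]`. -/
noncomputable def mulEnergyInt (R : ℕ) : Finset ((ℤ × ℤ) × (ℤ × ℤ)) :=
  ((Finset.Icc (-(R : ℤ)) R ×ˢ Finset.Icc (-(R : ℤ)) R) ×ˢ
    (Finset.Icc (-(R : ℤ)) R ×ˢ Finset.Icc (-(R : ℤ)) R)).filter
      fun q => q.1.1 * q.1.2 = q.2.1 * q.2.2

/-- An integer is determined by its absolute value and one sign bit; four variables give 16
patterns. -/
theorem card_mulEnergyInt_le_nat (R : ℕ) :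
    (mulEnergyInt R).card ≤ 16 * (mulEnergyNat R).card := by
  have h16 : (Finset.univ : Finset ((Bool × Bool) × (Bool × Bool))).card = 16 := by simp
  rw [← h16, ← Finset.card_product]
  refine Finset.card_le_card_of_injOn (fun q =>
    (((decide (0 ≤ q.1.1), decide (0 ≤ q.1.2)), (decide (0 ≤ q.2.1), decide (0 ≤ q.2.2))),
      ((q.1.1.natAbs, q.1.2.natAbs), (q.2.1.natAbs, q.2.2.natAbs)))) ?_ ?_
  · rintro ⟨⟨h, k⟩, ⟨h', k'⟩⟩ hq
    simp only [mulEnergyInt, Finset.coe_filter, Set.mem_ofPred_eq, Finset.mem_product,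
      Finset.mem_Icc] at hq
    simp only [mulEnergyNat, Finset.coe_product, Set.mem_prod, Finset.mem_coe, Finset.mem_univ,
      true_and, Finset.mem_filter, Finset.mem_product, Finset.mem_range]
    refine ⟨⟨⟨by omega, by omega⟩, by omega, by omega⟩, ?_⟩
    rw [← Int.natAbs_mul, ← Int.natAbs_mul, hq.2]
  · rintro ⟨⟨h, k⟩, ⟨h', k'⟩⟩ _ ⟨⟨u, v⟩, ⟨u', v'⟩⟩ _ heq
    simp only [Prod.mk.injEq, decide_eq_decide] at heq ⊢
    omega

theorem card_mulEnergyInt_le {R : ℕ} (hR : 1 ≤ R) :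
    ((mulEnergyInt R).card : ℝ) ≤ 272 * (R : ℝ) ^ 2 * (1 + Real.log R) ^ 2 := by
  have h1 : ((mulEnergyInt R).card : ℝ) ≤ 16 * (mulEnergyNat R).card := by
    exact_mod_cast card_mulEnergyInt_le_nat R
  have h2 : ((mulEnergyNat R).card : ℝ)
      ≤ ((2 * (R + 1)) ^ 2 : ℝ) + (R : ℝ) ^ 2 * (1 + Real.log R) ^ 2 := by
    rw [← Finset.card_filter_add_card_filter_not (s := mulEnergyNat R)
      (fun q => q.1.1 * q.1.2 = 0)]
    push_cast
    refine add_le_add ?_ (card_mulEnergyNat_pos_le R)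
    exact_mod_cast card_mulEnergyNat_zero_le R
  have hR' : (1 : ℝ) ≤ R := by exact_mod_cast hR
  have hlog : 0 ≤ Real.log R := Real.log_nonneg hR'
  -- The degenerate solutions cost 16R², the others R² times the squared logarithm: 16 · (16 + 1) =
  -- 272.
  have h3 : ((2 * (R + 1)) ^ 2 : ℝ) ≤ 16 * (R : ℝ) ^ 2 := by nlinarith
  have h4 : (R : ℝ) ^ 2 * 1 ≤ (R : ℝ) ^ 2 * (1 + Real.log R) ^ 2 := by
    gcongr
    nlinarith
  nlinarith

/-! ### Weyl differencing -/

/-- The quadratic Weyl sum `∑_{|n| ≤ N} u ^ n w ^ (n ^ 2)`. -/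
noncomputable def weylSum (N : ℕ) (u w : ℂ) : ℂ :=
  ∑ n ∈ Finset.Icc (-(N : ℤ)) N, u ^ n * w ^ (n ^ 2)

/-- The majorant of the squared Weyl sum obtained by differencing; it does not involve the linear
phase. -/
noncomputable def weylMajorant (R : ℕ) (w : ℂ) : ℝ :=
  ∑ h ∈ Finset.Icc (-(R : ℤ)) R, fejerMajorant R (w ^ (2 * h))

theorem weylMajorant_nonneg (R : ℕ) (w : ℂ) : 0 ≤ weylMajorant R w :=
  Finset.sum_nonneg fun _ _ => fejerMajorant_nonneg _ _

theorem weylMajorant_mono {R R' : ℕ} (h : R ≤ R') (w : ℂ) :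
    weylMajorant R w ≤ weylMajorant R' w := by
  refine (Finset.sum_le_sum fun _ _ => fejerMajorant_mono h _).trans ?_
  exact Finset.sum_le_sum_of_subset_of_nonneg
    (Finset.Icc_subset_Icc (by omega) (by omega)) fun _ _ _ => fejerMajorant_nonneg _ _

/-- After n = m + h the phase n² - m² = h² + 2hm is linear in m. The factors u^h and w^(h²) are
unimodular and disappear, leaving geometric sums in w^(2h). -/
theorem norm_weylSum_sq_le {u w : ℂ} (hu : ‖u‖ = 1) (hw : ‖w‖ = 1) (N : ℕ) :
    ‖weylSum N u w‖ ^ 2 ≤ 16 * weylMajorant (2 * N + 1) w := by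
  have hu0 : u ≠ 0 := by rintro rfl; simp at hu
  have hw0 : w ≠ 0 := by rintro rfl; simp at hw
  set I := Finset.Icc (-(N : ℤ)) N with hI
  set J := Finset.Icc (-((2 * N + 1 : ℕ) : ℤ)) (2 * N + 1 : ℕ) with hJ
  have h1 : ((‖weylSum N u w‖ ^ 2 : ℝ) : ℂ)
      = ∑ m ∈ I, ∑ n ∈ I, u ^ (n - m) * w ^ (n ^ 2 - m ^ 2) := by
    push_cast
    rw [← Complex.mul_conj', weylSum, map_sum, Finset.sum_mul_sum, Finset.sum_comm]
    refine Finset.sum_congr rfl fun m _ => Finset.sum_congr rfl fun n _ => ?_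
    rw [map_mul, map_zpow₀, map_zpow₀, ← Complex.inv_eq_conj hu, ← Complex.inv_eq_conj hw,
      zpow_sub₀ hu0, zpow_sub₀ hw0, inv_zpow, inv_zpow]
    ring
  have h2 : ∀ m ∈ I, ∑ n ∈ I, u ^ (n - m) * w ^ (n ^ 2 - m ^ 2)
      = ∑ h ∈ J, if m + h ∈ I then u ^ h * w ^ (h ^ 2) * (w ^ (2 * h)) ^ m else 0 := by
    intro m hm
    rw [← Finset.sum_filter]
    refine Finset.sum_bij (fun n _ => n - m) ?_ ?_ ?_ ?_
    · intro n hn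
      simp only [hI, hJ, Finset.mem_filter, Finset.mem_Icc] at *
      omega
    · intro n _ n' _ h
      omega
    · intro h hh
      simp only [hI, hJ, Finset.mem_filter, Finset.mem_Icc] at hh hm
      exact ⟨m + h, by simp only [hI, Finset.mem_Icc]; omega, by omega⟩
    · intro n _
      rw [← zpow_mul, mul_assoc, ← zpow_add₀ hw0]
      congr 2
      ring
  rw [Finset.sum_congr rfl h2, Finset.sum_comm] at h1
  have h3 : ‖weylSum N u w‖ ^ 2 = ‖((‖weylSum N u w‖ ^ 2 : ℝ) : ℂ)‖ := by
    rw [Complex.norm_real, Real.norm_of_nonneg (by positivity)]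
  rw [h3, h1, weylMajorant, Finset.mul_sum]
  refine (norm_sum_le _ _).trans (Finset.sum_le_sum fun h _ => ?_)
  rw [← Finset.sum_filter, ← Finset.mul_sum, norm_mul, norm_mul, norm_zpow, norm_zpow, hu, hw,
    one_zpow, one_zpow, one_mul, one_mul]
  -- The admissible m form an interval, possibly empty, of at most 2N + 1 integers.
  have h4 : I.filter (fun m => m + h ∈ I)
      = Finset.Icc (max (-(N : ℤ)) (-N - h)) (min (N : ℤ) (N - h)) := by
    ext m
    simp only [hI, Finset.mem_filter, Finset.mem_Icc]
    omega
  rw [h4]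
  exact norm_zpow_sum_Icc_le (by rw [norm_zpow, hw, one_zpow]) _ _ (by push_cast; omega)

/-! ### Orthogonality and mean squares -/

theorem fourier_eq_zpow (n : ℤ) (t : UnitAddCircle) : fourier n t = (fourier 1 t : ℂ) ^ n := by
  rw [fourier_apply, fourier_one, AddCircle.toCircle_zsmul, Circle.coe_zpow]

theorem norm_fourier_apply (n : ℤ) (t : UnitAddCircle) : ‖(fourier n t : ℂ)‖ = 1 := by
  rw [fourier_apply]; exact Circle.norm_coe _

theorem integral_fourier (n : ℤ) :
    ∫ t : UnitAddCircle, (fourier n t : ℂ) = if n = 0 then 1 else 0 := by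
  split_ifs with h
  · subst h; simp [Measure.real]
  · exact integral_eq_zero_of_add_right_eq_neg (fourier_add_half_inv_index h one_pos)

theorem integrable_of_continuous {X E : Type*} [TopologicalSpace X] [CompactSpace X]
    [MeasurableSpace X] [OpensMeasurableSpace X] [NormedAddCommGroup E] {μ : Measure X}
    [IsFiniteMeasureOnCompacts μ] {f : X → E} (hf : Continuous f) : Integrable f μ :=
  hf.integrable_of_hasCompactSupport (HasCompactSupport.of_compactSpace f)

/-- Frequencies may repeat: the coincidences φ i = φ j are exactly what turns the mean square of
`weylMajorant` into a count. -/
theorem integral_norm_sq_trigPoly {ι : Type*} (s : Finset ι) (a : ι → ℂ) (φ : ι → ℤ) :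
    ((∫ t : UnitAddCircle, ‖∑ i ∈ s, a i * fourier (φ i) t‖ ^ 2 : ℝ) : ℂ)
      = ∑ i ∈ s, ∑ j ∈ s, if φ i = φ j then a i * (starRingEnd ℂ) (a j) else 0 := by
  rw [← integral_complex_ofReal]
  have h1 : ∀ t : UnitAddCircle, ((‖∑ i ∈ s, a i * fourier (φ i) t‖ ^ 2 : ℝ) : ℂ)
      = ∑ i ∈ s, ∑ j ∈ s, a i * (starRingEnd ℂ) (a j) * fourier (φ i - φ j) t := by
    intro t
    push_cast
    rw [← Complex.mul_conj', map_sum, Finset.sum_mul_sum]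
    refine Finset.sum_congr rfl fun i _ => Finset.sum_congr rfl fun j _ => ?_
    rw [map_mul, ← fourier_neg, sub_eq_add_neg, fourier_add]
    ring
  simp only [h1]
  rw [integral_finsetSum]
  · refine Finset.sum_congr rfl fun i _ => ?_
    rw [integral_finsetSum]
    · refine Finset.sum_congr rfl fun j _ => ?_
      rw [integral_const_mul, integral_fourier]
      simp [sub_eq_zero]
    · exact fun j _ => integrable_of_continuous (by fun_prop)
  · exact fun j _ => integrable_of_continuous (by fun_prop)

theorem continuous_weylMajorant (R : ℕ) :
    Continuous fun t : UnitAddCircle => weylMajorant R (fourier 1 t) := by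
  simp only [weylMajorant, fejerMajorant, ← fourier_eq_zpow]
  fun_prop

/-- The frequencies are 2hj, so coincidences are the elements of `mulEnergyInt R`; each carries two
coefficients of size at most 1 + log R. -/
theorem integral_weylMajorant_sq_le {R : ℕ} (hR : 1 ≤ R) :
    ∫ t : UnitAddCircle, weylMajorant R (fourier 1 t) ^ 2
      ≤ 272 * (R : ℝ) ^ 2 * (1 + Real.log R) ^ 4 := by
  obtain ⟨c, hc0, hc, hexp⟩ := exists_fejerMajorant_coeff R
  let s := Finset.Icc (-(R : ℤ)) R ×ˢ Finset.Icc (-(R : ℤ)) R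
  have h1 : ∀ t : UnitAddCircle, weylMajorant R (fourier 1 t) ^ 2
      = ‖∑ p ∈ s, (c p.2 : ℂ) * fourier (2 * p.1 * p.2) t‖ ^ 2 := by
    intro t
    have : (weylMajorant R (fourier 1 t) : ℂ)
        = ∑ p ∈ s, (c p.2 : ℂ) * fourier (2 * p.1 * p.2) t := by
      rw [weylMajorant, Finset.sum_product]
      push_cast
      refine Finset.sum_congr rfl fun h _ => ?_
      rw [hexp _ (by rw [norm_zpow, norm_fourier_apply, one_zpow])]
      refine Finset.sum_congr rfl fun j _ => ?_
      rw [fourier_eq_zpow (2 * h * j), zpow_mul _ (2 * h) j]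
    rw [← this, Complex.norm_real, Real.norm_of_nonneg (weylMajorant_nonneg _ _)]
  simp only [h1]
  have h2 := integral_norm_sq_trigPoly s (fun p => (c p.2 : ℂ)) (fun p => 2 * p.1 * p.2)
  have h3 : ∫ t : UnitAddCircle, ‖∑ p ∈ s, (c p.2 : ℂ) * fourier (2 * p.1 * p.2) t‖ ^ 2
      = ∑ p ∈ s, ∑ q ∈ s, if 2 * p.1 * p.2 = 2 * q.1 * q.2 then c p.2 * c q.2 else 0 := by
    apply Complex.ofReal_injective
    rw [h2]
    push_cast
    refine Finset.sum_congr rfl fun p _ => Finset.sum_congr rfl fun q _ => ?_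
    split_ifs <;> simp
  rw [h3, ← Finset.sum_product', ← Finset.sum_filter]
  have h4 : (s ×ˢ s).filter (fun q => 2 * q.1.1 * q.1.2 = 2 * q.2.1 * q.2.2) = mulEnergyInt R := by
    rw [mulEnergyInt]
    refine Finset.filter_congr fun q _ => ?_
    rw [mul_assoc, mul_assoc]
    exact mul_right_inj' two_ne_zero
  rw [h4]
  have hlog : 0 ≤ 1 + Real.log R := (hc0 0).trans (hc 0)
  calc _ ≤ ∑ q ∈ mulEnergyInt R, (1 + Real.log R) * (1 + Real.log R) :=
        Finset.sum_le_sum fun q _ => mul_le_mul (hc _) (hc _) (hc0 _) hlog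
    _ = (mulEnergyInt R).card * (1 + Real.log R) ^ 2 := by
        rw [Finset.sum_const, nsmul_eq_mul]; ring
    _ ≤ (272 * (R : ℝ) ^ 2 * (1 + Real.log R) ^ 2) * (1 + Real.log R) ^ 2 := by
        gcongr
        exact card_mulEnergyInt_le hR
    _ = _ := by ring

theorem integral_norm_weylSum_sq (N : ℕ) {w : ℂ} (hw : ‖w‖ = 1) :
    ∫ x : UnitAddCircle, ‖weylSum N (fourier 1 x) w‖ ^ 2 = 2 * N + 1 := by
  have h := integral_norm_sq_trigPoly (Finset.Icc (-(N : ℤ)) N) (fun n => w ^ (n ^ 2)) id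
  have h1 : ∀ x : UnitAddCircle, weylSum N (fourier 1 x) w
      = ∑ n ∈ Finset.Icc (-(N : ℤ)) N, w ^ (n ^ 2) * fourier (id n) x := by
    intro x
    refine Finset.sum_congr rfl fun n _ => ?_
    rw [id, fourier_eq_zpow n, mul_comm]
  simp only [h1]
  apply Complex.ofReal_injective
  rw [h]
  have h2 : ∀ n : ℤ, w ^ (n ^ 2) * (starRingEnd ℂ) (w ^ (n ^ 2)) = 1 := by
    intro n
    rw [Complex.mul_conj', norm_zpow, hw]; simp
  simp only [id, Finset.sum_ite_eq]
  rw [Finset.sum_congr rfl (g := fun _ => (1 : ℂ))]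
  · simp
    have : ((N : ℤ) + 1 + N).toNat = 2 * N + 1 := by omega
    rw [this]; push_cast; ring
  · intro n hn
    rw [if_pos hn, h2]

/-! ### The upper bound -/

theorem expSum_eq_prod_weylSum {d : ℕ} (N : Fin d → ℕ)
    (z : (Fin d → UnitAddCircle) × UnitAddCircle) :
    expSum N z = ∏ j, weylSum (N j) (fourier 1 (z.1 j)) (fourier 1 z.2) := by
  simp only [expSum, weylSum, freqBox, Finset.prod_univ_sum]
  refine Finset.sum_congr rfl fun n _ => ?_
  have hw0 : (fourier 1 z.2 : ℂ) ≠ 0 := by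
    rw [← norm_ne_zero_iff, norm_fourier_apply]; exact one_ne_zero
  have h1 : ∀ s : Finset (Fin d), (fourier 1 z.2 : ℂ) ^ (∑ j ∈ s, n j ^ 2)
      = ∏ j ∈ s, (fourier 1 z.2 : ℂ) ^ (n j ^ 2) := by
    intro s
    induction s using Finset.cons_induction with
    | empty => simp
    | cons a s ha ih => rw [Finset.sum_cons, Finset.prod_cons, zpow_add₀ hw0, ih]
  rw [Finset.prod_mul_distrib, fourier_eq_zpow (∑ j, n j ^ 2), h1]
  congr 1
  exact Finset.prod_congr rfl fun j _ => fourier_eq_zpow _ _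

theorem continuous_expSum {d : ℕ} (N : Fin d → ℕ) : Continuous (expSum N) := by
  unfold expSum
  fun_prop

theorem expSumNorm_eq {d : ℕ} (hd : 1 ≤ d) (N : Fin d → ℕ) :
    expSumNorm N = ENNReal.ofReal
      ((∫ z, ‖expSum N z‖ ^ (2 * ((d : ℝ) + 2) / d)) ^ ((d : ℝ) / (2 * (d + 2)))) := by
  have hd' : (0 : ℝ) < d := by exact_mod_cast hd
  have hp : 0 < 2 * ((d : ℝ) + 2) / d := by positivity
  rw [expSumNorm, MemLp.eLpNorm_eq_integral_rpow_norm
    (by simpa using hp) ENNReal.ofReal_ne_top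
    ((continuous_expSum N).memLp_of_hasCompactSupport (HasCompactSupport.of_compactSpace _)),
    ENNReal.toReal_ofReal hp.le, inv_div]

theorem norm_expSum_rpow_le {d : ℕ} (hd : 1 ≤ d) (N : Fin d → ℕ) {R : ℕ}
    (hR : ∀ j, 2 * N j + 1 ≤ R) (z : (Fin d → UnitAddCircle) × UnitAddCircle) :
    ‖expSum N z‖ ^ (2 * ((d : ℝ) + 2) / d)
      ≤ (∏ j, ‖weylSum (N j) (fourier 1 (z.1 j)) (fourier 1 z.2)‖ ^ 2)
        * (256 * weylMajorant R (fourier 1 z.2) ^ 2) := by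
  have hd' : (0 : ℝ) < d := by exact_mod_cast hd
  have hW := weylMajorant_nonneg R (fourier 1 z.2)
  have h1 : ‖expSum N z‖ ^ 2
      = ∏ j, ‖weylSum (N j) (fourier 1 (z.1 j)) (fourier 1 z.2)‖ ^ 2 := by
    rw [expSum_eq_prod_weylSum, norm_prod, Finset.prod_pow]
  have h2 : ‖expSum N z‖ ^ 2 ≤ (16 * weylMajorant R (fourier 1 z.2)) ^ d := by
    rw [h1]
    refine (Finset.prod_le_prod (fun _ _ => by positivity) fun j _ =>
      (norm_weylSum_sq_le (norm_fourier_apply _ _) (norm_fourier_apply _ _) (N j)).trans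
        (mul_le_mul_of_nonneg_left (weylMajorant_mono (hR j) _) (by norm_num))).trans ?_
    simp
  -- The exponent 2/d undoes the d-fold product, so exactly the square of the majorant remains, in
  -- every dimension.
  have h3 : (‖expSum N z‖ ^ 2) ^ (2 / (d : ℝ)) ≤ 256 * weylMajorant R (fourier 1 z.2) ^ 2 := by
    refine (Real.rpow_le_rpow (by positivity) h2 (by positivity)).trans_eq ?_
    rw [← Real.rpow_natCast, ← Real.rpow_mul (by positivity), mul_div_cancel₀ _ hd'.ne',
      show (2 : ℝ) = (2 : ℕ) by norm_num, Real.rpow_natCast]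
    ring
  have h4 : ‖expSum N z‖ ^ (2 * ((d : ℝ) + 2) / d)
      = ‖expSum N z‖ ^ 2 * (‖expSum N z‖ ^ 2) ^ (2 / (d : ℝ)) := by
    rw [← Real.rpow_natCast, ← Real.rpow_mul (norm_nonneg _), ← Real.rpow_add_of_nonneg
      (norm_nonneg _) (by positivity) (by positivity)]
    congr 1
    push_cast
    field_simp
  rw [h4, h1] at *
  exact mul_le_mul_of_nonneg_left h3 (Finset.prod_nonneg fun _ _ => by positivity)

theorem continuous_norm_weylSum_sq (N : ℕ) :
    Continuous fun y : UnitAddCircle × UnitAddCircle =>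
      ‖weylSum N (fourier 1 y.1) (fourier 1 y.2)‖ ^ 2 := by
  simp only [weylSum, ← fourier_eq_zpow]
  fun_prop

/-- For fixed t the majorant is constant in x and the x-integral splits over coordinates; its value
does not depend on t. -/
theorem integral_norm_expSum_rpow_le {d : ℕ} (hd : 1 ≤ d) (N : Fin d → ℕ) {R : ℕ}
    (hR1 : 1 ≤ R) (hR : ∀ j, 2 * N j + 1 ≤ R) :
    ∫ z, ‖expSum N z‖ ^ (2 * ((d : ℝ) + 2) / d)
      ≤ (∏ j, (2 * (N j : ℝ) + 1)) * (256 * (272 * (R : ℝ) ^ 2 * (1 + Real.log R) ^ 4)) := by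
  have hd' : (0 : ℝ) < d := by exact_mod_cast hd
  have hcW : Continuous fun z : (Fin d → UnitAddCircle) × UnitAddCircle =>
      weylMajorant R (fourier 1 z.2) := (continuous_weylMajorant R).comp continuous_snd
  have hcP : Continuous fun z : (Fin d → UnitAddCircle) × UnitAddCircle =>
      ∏ j, ‖weylSum (N j) (fourier 1 (z.1 j)) (fourier 1 z.2)‖ ^ 2 := by
    refine continuous_finsetProd _ fun j _ => ?_
    exact (continuous_norm_weylSum_sq (N j)).comp
      (f := fun z : (Fin d → UnitAddCircle) × UnitAddCircle => (z.1 j, z.2)) (by fun_prop)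
  have hint : Integrable (fun z : (Fin d → UnitAddCircle) × UnitAddCircle =>
      (∏ j, ‖weylSum (N j) (fourier 1 (z.1 j)) (fourier 1 z.2)‖ ^ 2)
        * (256 * weylMajorant R (fourier 1 z.2) ^ 2)) volume :=
    integrable_of_continuous (hcP.mul (by fun_prop))
  calc _ ≤ ∫ z : (Fin d → UnitAddCircle) × UnitAddCircle,
        (∏ j, ‖weylSum (N j) (fourier 1 (z.1 j)) (fourier 1 z.2)‖ ^ 2)
        * (256 * weylMajorant R (fourier 1 z.2) ^ 2) := by
        refine integral_mono (integrable_of_continuous ?_) hint fun z =>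
          norm_expSum_rpow_le hd N hR z
        exact (continuous_expSum N).norm.rpow_const fun _ => Or.inr (by positivity)
    _ = ∫ t : UnitAddCircle, (∏ j, (2 * (N j : ℝ) + 1))
          * (256 * weylMajorant R (fourier 1 t) ^ 2) := by
        rw [Measure.volume_eq_prod] at hint ⊢
        rw [integral_prod_symm _ hint]
        refine integral_congr_ae (Filter.Eventually.of_forall fun t => ?_)
        simp only
        rw [integral_mul_const, integral_fintype_prod_volume_eq_prod
          (fun j x => ‖weylSum (N j) (fourier 1 x) (fourier 1 t)‖ ^ 2)]
        congr 1
        exact Finset.prod_congr rfl fun j _ =>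
          integral_norm_weylSum_sq (N j) (norm_fourier_apply _ _)
    _ = (∏ j, (2 * (N j : ℝ) + 1))
          * (256 * ∫ t : UnitAddCircle, weylMajorant R (fourier 1 t) ^ 2) := by
        rw [integral_const_mul, integral_const_mul]
    _ ≤ _ := by
        refine mul_le_mul_of_nonneg_left ?_ (Finset.prod_nonneg fun _ _ => by positivity)
        linarith [integral_weylMajorant_sq_le hR1]

theorem one_add_log_pow_four_le {η x : ℝ} (hη : 0 < η) (hx : 1 ≤ x) :
    (1 + Real.log x) ^ 4 ≤ (1 + 4 / η) ^ 4 * x ^ η := by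
  have h1 : 1 + Real.log x ≤ (1 + 4 / η) * x ^ (η / 4) := by
    have h2 := Real.log_le_rpow_div (x := x) (ε := η / 4) (by linarith) (by positivity)
    have h3 : 1 ≤ x ^ (η / 4) := Real.one_le_rpow hx (by positivity)
    calc 1 + Real.log x ≤ x ^ (η / 4) + x ^ (η / 4) / (η / 4) := by linarith
      _ = _ := by field_simp
  have h0 : 0 ≤ 1 + Real.log x := by linarith [Real.log_nonneg hx]
  refine (pow_le_pow_left₀ h0 h1 4).trans_eq ?_
  rw [mul_pow, ← Real.rpow_natCast (x ^ (η / 4)), ← Real.rpow_mul (by linarith)]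
  congr 2
  push_cast
  ring

theorem exists_integral_norm_expSum_rpow_le {d : ℕ} (hd : 1 ≤ d) {η : ℝ} (hη : 0 < η) :
    ∃ C : ℝ, 0 < C ∧ ∀ N : Fin d → ℕ, (∀ j, 1 ≤ N j) →
      ∫ z, ‖expSum N z‖ ^ (2 * ((d : ℝ) + 2) / d)
        ≤ C * (∏ j, (N j : ℝ)) * ((Finset.univ.sup N : ℕ) : ℝ) ^ (2 + η) := by
  -- The factor 3^d comes from 2N_j + 1 ≤ 3N_j, and 3^(2+η) from taking R = 3M.
  refine ⟨3 ^ d * (256 * 272 * (1 + 4 / η) ^ 4) * 3 ^ (2 + η), by positivity, fun N hN => ?_⟩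
  set M := Finset.univ.sup N with hM
  have hNM : ∀ j, N j ≤ M := fun j => Finset.le_sup (Finset.mem_univ j)
  have hM1 : 1 ≤ M := (hN ⟨0, hd⟩).trans (hNM _)
  have hM1' : (1 : ℝ) ≤ M := by exact_mod_cast hM1
  refine (integral_norm_expSum_rpow_le hd N (R := 3 * M) (by omega)
    fun j => by have := hNM j; omega).trans ?_
  have h1 : ∏ j, (2 * (N j : ℝ) + 1) ≤ 3 ^ d * ∏ j, (N j : ℝ) := by
    calc _ ≤ ∏ j, (3 * (N j : ℝ)) := by
          refine Finset.prod_le_prod (fun _ _ => by positivity) fun j _ => ?_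
          have : (1 : ℝ) ≤ N j := by exact_mod_cast hN j
          linarith
      _ = _ := by rw [Finset.prod_mul_distrib]; simp
  have hR : (1 : ℝ) ≤ ((3 * M : ℕ) : ℝ) := by exact_mod_cast (by omega : 1 ≤ 3 * M)
  have h2 := one_add_log_pow_four_le hη hR
  calc _ ≤ (3 ^ d * ∏ j, (N j : ℝ)) * (256 * (272 * ((3 * M : ℕ) : ℝ) ^ 2
          * ((1 + 4 / η) ^ 4 * ((3 * M : ℕ) : ℝ) ^ η))) := by gcongr
    _ = 3 ^ d * (256 * 272 * (1 + 4 / η) ^ 4) * (∏ j, (N j : ℝ))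
          * ((3 * M : ℕ) : ℝ) ^ (2 + η) := by
        rw [Real.rpow_add (by linarith), Real.rpow_two]; ring
    _ = _ := by
        push_cast
        rw [Real.mul_rpow (by norm_num) (by positivity)]
        ring

theorem exists_expSumNorm_le {d : ℕ} (hd : 1 ≤ d) {ε : ℝ} (hε : 0 < ε) :
    ∃ C : ℝ, 0 < C ∧ ∀ N : Fin d → ℕ, (∀ j, 1 ≤ N j) →
      expSumNorm N ≤ ENNReal.ofReal
        (C * (∏ j, (N j : ℝ)) ^ ((d : ℝ) / (2 * ((d : ℝ) + 2))) *
          ((Finset.univ.sup N : ℕ) : ℝ) ^ ((d : ℝ) / ((d : ℝ) + 2) + ε)) := by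
  have hd' : (0 : ℝ) < d := by exact_mod_cast hd
  obtain ⟨C, hC, hbound⟩ := exists_integral_norm_expSum_rpow_le hd
    -- This is εp, which becomes ε after the p-th root.
    (η := ε * (2 * ((d : ℝ) + 2) / d)) (by positivity)
  refine ⟨C ^ ((d : ℝ) / (2 * ((d : ℝ) + 2))), by positivity, fun N hN => ?_⟩
  rw [expSumNorm_eq hd]
  refine ENNReal.ofReal_le_ofReal ?_
  have h0 : 0 ≤ ∏ j, (N j : ℝ) := Finset.prod_nonneg fun _ _ => by positivity
  refine (Real.rpow_le_rpow (integral_nonneg fun _ => by positivity) (hbound N hN)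
    (by positivity)).trans_eq ?_
  rw [Real.mul_rpow (by positivity) (by positivity), Real.mul_rpow hC.le h0,
    ← Real.rpow_mul (by positivity)]
  congr 2
  field_simp

/-! ### The lower bound near the origin -/

theorem exists_coe_eq_abs_eq_norm (y : UnitAddCircle) :
    ∃ x : ℝ, (x : UnitAddCircle) = y ∧ |x| = ‖y‖ := by
  induction y using QuotientAddGroup.induction_on with
  | H x =>
    refine ⟨x - round x, ?_, ?_⟩
    · have : ((round x : ℝ) : UnitAddCircle) = 0 := by
        rw [AddCircle.coe_eq_zero_iff]
        exact ⟨round x, by simp⟩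
      rw [AddCircle.coe_sub, this, sub_zero]
    · exact (UnitAddCircle.norm_eq (x := x)).symm

theorem half_le_re_exp_mul_exp {a b : ℝ} (h : |a + b| ≤ 1 / 6) :
    1 / 2 ≤ (Complex.exp (2 * Real.pi * Complex.I * a) *
      Complex.exp (2 * Real.pi * Complex.I * b)).re := by
  have h1 : 2 * Real.pi * Complex.I * a + 2 * Real.pi * Complex.I * b
      = ((2 * Real.pi * (a + b) : ℝ) : ℂ) * Complex.I := by push_cast; ring
  rw [← Complex.exp_add, h1, Complex.exp_ofReal_mul_I_re, ← Real.cos_pi_div_three,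
    ← Real.cos_abs (2 * Real.pi * (a + b))]
  have h2 : |2 * Real.pi * (a + b)| ≤ Real.pi / 3 := by
    rw [abs_mul, abs_of_pos (by positivity)]
    nlinarith [Real.pi_pos]
  exact Real.cos_le_cos_of_nonneg_of_le_pi (abs_nonneg _) (by linarith [Real.pi_pos]) h2

/-- The linear and quadratic phases are each at most 1/12 of a turn, so every term has real part at
least cos(π/3) = 1/2. -/
theorem half_card_le_norm_expSum {d : ℕ} (hd : 1 ≤ d) {M : ℕ} (hM : 1 ≤ M)
    {z : (Fin d → UnitAddCircle) × UnitAddCircle}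
    (hx : ∀ j, ‖z.1 j‖ ≤ 1 / (12 * d) / M) (ht : ‖z.2‖ ≤ 1 / (12 * d) / (M : ℝ) ^ 2) :
    (M : ℝ) ^ d / 2 ≤ ‖expSum (fun _ : Fin d => M) z‖ := by
  have hd' : (0 : ℝ) < d := by exact_mod_cast hd
  have hM' : (0 : ℝ) < M := by exact_mod_cast hM
  obtain ⟨y, t⟩ := z
  choose x hxy hxn using fun j => exists_coe_eq_abs_eq_norm (y j)
  obtain ⟨s, rfl, hs⟩ := exists_coe_eq_abs_eq_norm t
  obtain rfl : (fun j => (x j : UnitAddCircle)) = y := funext hxy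
  simp only [← hxn, ← hs] at hx ht
  refine le_trans ?_ (Complex.re_le_norm _)
  rw [expSum_coe, Complex.re_sum]
  have h1 : ∀ n ∈ freqBox (fun _ : Fin d => M), (1 / 2 : ℝ) ≤
      (Complex.exp (2 * Real.pi * Complex.I * ∑ j, (n j : ℂ) * (x j : ℂ)) *
        Complex.exp (2 * Real.pi * Complex.I * (∑ j, (n j : ℂ) ^ 2) * (s : ℂ))).re := by
    intro n hn
    simp only [freqBox, Fintype.mem_piFinset, Finset.mem_Icc] at hn
    have hn' : ∀ j, |(n j : ℝ)| ≤ M := fun j => by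
      rw [abs_le]; exact ⟨by exact_mod_cast (hn j).1, by exact_mod_cast (hn j).2⟩
    have ha : |∑ j, (n j : ℝ) * x j| ≤ 1 / 12 := by
      refine (Finset.abs_sum_le_sum_abs _ _).trans ?_
      calc _ ≤ ∑ j : Fin d, (M : ℝ) * (1 / (12 * d) / M) := by
            refine Finset.sum_le_sum fun j _ => ?_
            rw [abs_mul]
            exact mul_le_mul (hn' j) (hx j) (abs_nonneg _) hM'.le
        _ = 1 / 12 := by
            rw [Finset.sum_const, Finset.card_univ, Fintype.card_fin, nsmul_eq_mul]
            field_simp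
    have hb : |(∑ j, (n j : ℝ) ^ 2) * s| ≤ 1 / 12 := by
      rw [abs_mul, abs_of_nonneg (Finset.sum_nonneg fun _ _ => sq_nonneg _)]
      have h2 : ∑ j, (n j : ℝ) ^ 2 ≤ d * (M : ℝ) ^ 2 := by
        calc _ ≤ ∑ j : Fin d, (M : ℝ) ^ 2 := by
              refine Finset.sum_le_sum fun j _ => ?_
              rw [← sq_abs]
              exact pow_le_pow_left₀ (abs_nonneg _) (hn' j) 2
          _ = _ := by simp
      calc _ ≤ (d * (M : ℝ) ^ 2) * (1 / (12 * d) / (M : ℝ) ^ 2) := by gcongr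
        _ = 1 / 12 := by field_simp
    have h3 := half_le_re_exp_mul_exp (a := ∑ j, (n j : ℝ) * x j) (b := (∑ j, (n j : ℝ) ^ 2) * s)
      ((abs_add_le _ _).trans (by linarith))
    push_cast at h3
    rwa [← mul_assoc] at h3
  refine le_trans ?_ (Finset.card_nsmul_le_sum _ _ _ h1)
  rw [nsmul_eq_mul, mul_one_div]
  have h2 : (M : ℝ) ^ d ≤ ((freqBox (fun _ : Fin d => M)).card : ℝ) := by
    have : (freqBox (fun _ : Fin d => M)).card = (2 * M + 1) ^ d := by
      rw [freqBox, Fintype.card_piFinset]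
      simp
      congr 1
      omega
    rw [this]
    exact_mod_cast Nat.pow_le_pow_left (by omega) d
  linarith

theorem exists_le_integral_norm_expSum_rpow {d : ℕ} (hd : 1 ≤ d) :
    ∃ c : ℝ, 0 < c ∧ ∀ M : ℕ, 1 ≤ M → c * (M : ℝ) ^ (d + 2) ≤
      ∫ z, ‖expSum (fun _ : Fin d => M) z‖ ^ (2 * ((d : ℝ) + 2) / d) := by
  have hd' : (0 : ℝ) < d := by exact_mod_cast hd
  have hd1 : (1 : ℝ) ≤ d := by exact_mod_cast hd
  refine ⟨(2 * (1 / (12 * d))) ^ (d + 1) * (1 / 2) ^ (2 * ((d : ℝ) + 2) / d), by positivity,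
    fun M hM => ?_⟩
  have hM' : (1 : ℝ) ≤ M := by exact_mod_cast hM
  set δ : ℝ := 1 / (12 * d) with hδ
  have hδ0 : 0 < δ := by positivity
  -- Keeps the balls from wrapping around the circle, so their volume is their diameter.
  have hδ1 : 2 * δ ≤ 1 := by
    rw [hδ, mul_one_div, div_le_one (by positivity)]; linarith
  let A : Set ((Fin d → UnitAddCircle) × UnitAddCircle) :=
    (Set.univ.pi fun _ => Metric.closedBall 0 (δ / M)) ×ˢ Metric.closedBall 0 (δ / (M : ℝ) ^ 2)
  have hAm : MeasurableSet A :=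
    (MeasurableSet.univ_pi fun _ => measurableSet_closedBall).prod measurableSet_closedBall
  have hball : ∀ K : ℝ, 1 ≤ K →
      volume (Metric.closedBall (0 : UnitAddCircle) (δ / K)) = ENNReal.ofReal (2 * δ / K) := by
    intro K hK
    rw [AddCircle.volume_closedBall, ← mul_div_assoc, min_eq_right]
    rw [div_le_one (by linarith)]
    linarith
  have hA : volume.real A = (2 * δ) ^ (d + 1) / (M : ℝ) ^ (d + 2) := by
    rw [Measure.real, Measure.volume_eq_prod, Measure.prod_prod, volume_pi_pi, hball _ hM']
    rw [hball _ (one_le_pow₀ hM')]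
    rw [Finset.prod_const, Finset.card_univ, Fintype.card_fin, ENNReal.toReal_mul,
      ENNReal.toReal_pow, ENNReal.toReal_ofReal (by positivity),
      ENNReal.toReal_ofReal (by positivity)]
    rw [div_pow, div_mul_div_comm, ← pow_succ, ← pow_add]
  have hint : Integrable (fun z => ‖expSum (fun _ : Fin d => M) z‖ ^ (2 * ((d : ℝ) + 2) / d))
      volume := integrable_of_continuous
    ((continuous_expSum _).norm.rpow_const fun _ => Or.inr (by positivity))
  refine le_trans ?_ (setIntegral_le_integral (s := A) hint
    (Filter.Eventually.of_forall fun _ => by positivity))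
  refine le_trans ?_ (setIntegral_mono_on (f := fun _ => ((M : ℝ) ^ d / 2) ^ (2 * ((d : ℝ) + 2) / d))
    (integrable_const _) hint.integrableOn hAm fun z hz => ?_)
  · rw [setIntegral_const, hA, smul_eq_mul, div_eq_mul_one_div ((M : ℝ) ^ d),
      Real.mul_rpow (by positivity) (by positivity), ← Real.rpow_natCast (M : ℝ) d,
      ← Real.rpow_mul (by positivity), mul_div_cancel₀ _ hd'.ne',
      show 2 * ((d : ℝ) + 2) = ((2 * (d + 2) : ℕ) : ℝ) by push_cast; ring, Real.rpow_natCast,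
      mul_comm 2 (d + 2), pow_mul]
    refine le_of_eq ?_
    field_simp
  · simp only [A, Set.mem_prod, Set.mem_univ_pi, mem_closedBall_zero_iff] at hz
    exact Real.rpow_le_rpow (by positivity) (half_card_le_norm_expSum hd hM hz.1 hz.2)
      (by positivity)

theorem exists_le_expSumNorm {d : ℕ} (hd : 1 ≤ d) :
    ∃ c : ℝ, 0 < c ∧ ∀ M : ℕ, 1 ≤ M →
      ENNReal.ofReal (c * (M : ℝ) ^ ((d : ℝ) / 2)) ≤ expSumNorm (fun _ : Fin d => M) := by
  have hd' : (0 : ℝ) < d := by exact_mod_cast hd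
  obtain ⟨c, hc, hbound⟩ := exists_le_integral_norm_expSum_rpow hd
  refine ⟨c ^ ((d : ℝ) / (2 * (d + 2))), by positivity, fun M hM => ?_⟩
  rw [expSumNorm_eq hd]
  refine ENNReal.ofReal_le_ofReal ?_
  refine le_trans (le_of_eq ?_) (Real.rpow_le_rpow (by positivity) (hbound M hM) (by positivity))
  rw [Real.mul_rpow hc.le (by positivity), ← Real.rpow_natCast (M : ℝ),
    ← Real.rpow_mul (by positivity)]
  congr 2
  push_cast
  field_simp

theorem theorem3 (d : ℕ) (hd : 1 ≤ d) :
    -- the estimate for boxes, and its special case for cubes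
    (∀ ε : ℝ, 0 < ε → ∃ C : ℝ, 0 < C ∧
      (∀ N : Fin d → ℕ, (∀ j, 1 ≤ N j) →
        expSumNorm N ≤ ENNReal.ofReal
          (C * (∏ j, (N j : ℝ)) ^ ((d : ℝ) / (2 * ((d : ℝ) + 2))) *
            ((Finset.univ.sup N : ℕ) : ℝ) ^ ((d : ℝ) / ((d : ℝ) + 2) + ε))) ∧
      (∀ M : ℕ, 1 ≤ M →
        expSumNorm (fun _ : Fin d => M) ≤ ENNReal.ofReal (C * (M : ℝ) ^ ((d : ℝ) / 2 + ε)))) ∧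
    -- the bound for cubes is sharp up to the factor with exponent `ε`
    (∃ c : ℝ, 0 < c ∧ ∀ M : ℕ, 1 ≤ M →
      ENNReal.ofReal (c * (M : ℝ) ^ ((d : ℝ) / 2)) ≤ expSumNorm (fun _ : Fin d => M)) := by
  refine ⟨fun ε hε => ?_, exists_le_expSumNorm hd⟩
  obtain ⟨C, hC, hbound⟩ := exists_expSumNorm_le hd hε
  refine ⟨C, hC, hbound, fun M hM => (hbound _ fun _ => hM).trans_eq ?_⟩
  have hM' : (0 : ℝ) < M := by exact_mod_cast hM
  have hd' : (0 : ℝ) < d := by exact_mod_cast hd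
  have hsup : Finset.univ.sup (fun _ : Fin d => M) = M :=
    Finset.sup_const ⟨⟨0, hd⟩, Finset.mem_univ _⟩ M
  -- For cubes the exponents combine as d²/(2(d+2)) + d/(d+2) = d/2.
  rw [hsup, Finset.prod_const, Finset.card_univ, Fintype.card_fin, mul_assoc,
    ← Real.rpow_natCast, ← Real.rpow_mul hM'.le, ← Real.rpow_add hM']
  congr 3
  field_simp
  ring
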